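/- A tiling of the plane is a countable collection of compact subsets of $\mathbb{R}^2$ (the tiles) whose union is $\mathbb{R}^2$ and such that distinct tiles have disjoint interiors. It is normal if there are $R>r>0$ such that each tile contains some ball of radius $r$ and is contained in some ball of radius $R$. (1) There is a normal tiling of the plane by pairwise non-congruent (nondegenerate) triangles of unit area, in which every triangle moreover has perimeter less than $100$. Here two sets are congruent if some isometry of the plane, possibly orientation reversing, maps one onto the other. (2) A tiling of the plane by triangles of unit area is normal if and only if the perimeters of its triangles are bounded by a common constant. -/

import Mathlib

namespace PlaneTiling

/-- The Euclidean plane. -/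
abbrev Plane : Type := EuclideanSpace ℝ (Fin 2)

/-- A tiling of the plane: a countable collection of compact sets (the tiles) such that the
interiors of distinct tiles are disjoint and the union of the tiles is the whole plane. -/
structure IsTiling (𝒯 : Set (Set Plane)) : Prop where
  countable : 𝒯.Countable
  isCompact : ∀ T ∈ 𝒯, IsCompact T
  packing : ∀ S ∈ 𝒯, ∀ T ∈ 𝒯, S ≠ T → Disjoint (interior S) (interior T)
  covering : ⋃₀ 𝒯 = Set.univ

/-- A collection of sets is normal if there are `R > r > 0` such that each of the sets contains
some ball of radius `r` and is contained in some ball of radius `R`. -/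
def IsNormal (𝒯 : Set (Set Plane)) : Prop :=
  ∃ r R : ℝ, 0 < r ∧ r < R ∧ ∀ T ∈ 𝒯,
    (∃ x : Plane, Metric.closedBall x r ⊆ T) ∧ (∃ y : Plane, T ⊆ Metric.closedBall y R)

/-- The set `T` is a (filled, nondegenerate) triangle with vertices the three affinely independent
points of `t`. -/
def IsTriangleWith (T : Set Plane) (t : Affine.Triangle ℝ Plane) : Prop :=
  T = convexHull ℝ (Set.range t.points)

/-- The set `T` is a (filled, nondegenerate) triangle. -/
def IsTriangle (T : Set Plane) : Prop :=
  ∃ t : Affine.Triangle ℝ Plane, IsTriangleWith T t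

/-- The set `T` is a triangle, and the sum of its three side lengths is `p`. -/
def HasPerimeter (T : Set Plane) (p : ℝ) : Prop :=
  ∃ t : Affine.Triangle ℝ Plane, IsTriangleWith T t ∧
    p = dist (t.points 0) (t.points 1) + dist (t.points 1) (t.points 2) +
      dist (t.points 2) (t.points 0)

/-- Congruence of subsets of the plane: some isometry of the plane (possibly orientation
reversing) maps one onto the other. -/
def AreCongruent (S T : Set Plane) : Prop :=
  ∃ f : Plane ≃ᵢ Plane, f '' S = T

/-- A tiling of the plane by triangles of unit area. -/
def IsUnitTriangleTiling (𝒯 : Set (Set Plane)) : Prop :=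
  IsTiling 𝒯 ∧ ∀ T ∈ 𝒯, IsTriangle T ∧ MeasureTheory.volume T = 1

end PlaneTiling

/-! The plane is cut into horizontal strips of height 2, and each strip into blocks. In block
coordinates of height 1, a block is a trapezoid with bottom `5 - 5 * ω` and top `5 * ω`, dissected
into five triangles of area 1/2, followed by a fan of 2 or 3 triangles with unit bases. Placement
doubles areas. All tops have length `5 * ω`, while bottoms have length `5 - 5 * ω + n` with `n`
equal to 2 or 3. Since `10 * ω = 5 + √5`, choosing `n` so that it averages `√5` keeps the
accumulated horizontal discrepancy, `offset`, in [0, 1). The left sides of the blocks therefore have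
bounded slant, and so the perimeters are bounded (`offset_succ`, `exists_perimeter_lt`).

Noncongruence comes from one more parameter, a shear `μ` of every strip. The sum of squared side
lengths is a congruence invariant and, for each tile, a quadratic polynomial in `μ`. Its two top
coefficients determine the prototile and the offset (`index_eq_of_moments_eq`). The offset
determines row and block, because `√5` is irrational and the rows have distinct rational shifts
(`offset_injective`). Two tiles thus have equal invariants for finitely many `μ` only, and there are
countably many pairs, so some `μ` in (0, 1) separates all tiles.

Normality amounts to bounded perimeter: unit area together with bounded sides forces a large
inscribed ball. -/

namespace PlaneTiling

open MeasureTheory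

/-! ### Triangles as intersections of half-planes. -/

/-- Twice the signed area of the triangle `a`, `b`, `z`. -/
def orient (a b z : Plane) : ℝ :=
  (b 0 - a 0) * (z 1 - a 1) - (b 1 - a 1) * (z 0 - a 0)

theorem mem_convexHull_range_three {p : Fin 3 → Plane} {z : Plane} :
    z ∈ convexHull ℝ (Set.range p) ↔ ∃ f : Fin 3 → ℝ, (∀ i, 0 ≤ f i) ∧ ∑ i, f i = 1 ∧
      ∑ i, f i • p i = z := by
  constructor
  · intro h
    rw [mem_convexHull_iff_exists_fintype] at h
    obtain ⟨ι, _, w, a, hw, hs, ha, rfl⟩ := h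
    choose g hg using ha
    classical
    refine ⟨fun i => ∑ j with g j = i, w j, fun i => Finset.sum_nonneg fun j _ => hw j, ?_, ?_⟩
    · rw [Finset.sum_fiberwise, hs]
    · rw [← Finset.sum_fiberwise _ g fun j => w j • a j]
      refine Finset.sum_congr rfl fun i _ => ?_
      rw [Finset.sum_smul]
      refine Finset.sum_congr rfl fun j hj => ?_
      rw [← hg, (Finset.mem_filter.1 hj).2]
  · rintro ⟨f, hf, hs, rfl⟩
    exact (convex_convexHull ℝ _).sum_mem (fun i _ => hf i) hs
      fun i _ => subset_convexHull ℝ _ ⟨i, rfl⟩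

theorem plane_ext {x y : Plane} (h0 : x 0 = y 0) (h1 : x 1 = y 1) : x = y := by
  ext i; fin_cases i
  · exact h0
  · exact h1

/-- The barycentric coordinates of `z` are the ratios of the signed areas it spans with the edges to
the whole area. -/
theorem mem_triangle_of_orient_nonneg {p : Fin 3 → Plane} (h : 0 < orient (p 0) (p 1) (p 2))
    {z : Plane} (h0 : 0 ≤ orient (p 0) (p 1) z) (h1 : 0 ≤ orient (p 1) (p 2) z)
    (h2 : 0 ≤ orient (p 2) (p 0) z) : z ∈ convexHull ℝ (Set.range p) := by
  rw [mem_convexHull_range_three]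
  refine ⟨![orient (p 1) (p 2) z / orient (p 0) (p 1) (p 2),
    orient (p 2) (p 0) z / orient (p 0) (p 1) (p 2),
    orient (p 0) (p 1) z / orient (p 0) (p 1) (p 2)], ?_, ?_, ?_⟩
  · intro i; fin_cases i <;> simp <;> positivity
  · simp only [Fin.sum_univ_three, Matrix.cons_val]
    rw [← add_div, ← add_div, div_eq_one_iff_eq h.ne']
    unfold orient; ring
  · have h' := h.ne'
    apply plane_ext <;> simp only [Fin.sum_univ_three, Matrix.cons_val, PiLp.add_apply,
      PiLp.smul_apply, smul_eq_mul] <;> field_simp <;> unfold orient <;> ring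

theorem orient_nonneg_of_mem_triangle {p : Fin 3 → Plane} {a b z : Plane}
    (hz : z ∈ convexHull ℝ (Set.range p)) (h : ∀ i, 0 ≤ orient a b (p i)) :
    0 ≤ orient a b z := by
  obtain ⟨f, hf, hs, rfl⟩ := mem_convexHull_range_three.1 hz
  have : orient a b (∑ i, f i • p i) = ∑ i, f i * orient a b (p i) := by
    simp only [Fin.sum_univ_three, orient, PiLp.add_apply, PiLp.smul_apply, smul_eq_mul] at hs ⊢
    obtain h2 : f 2 = 1 - f 0 - f 1 := by linarith
    rw [h2]; ring
  rw [this]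
  exact Finset.sum_nonneg fun i _ => mul_nonneg (hf i) (h i)

/-- `orient a b` is a nonconstant affine function, hence an open map: the image of the interior is
an open part of a closed half-line and misses its endpoint. -/
theorem orient_pos_of_mem_interior {a b z : Plane} {S : Set Plane} (hab : a ≠ b)
    (hS : ∀ x ∈ S, 0 ≤ orient a b x) (hz : z ∈ interior S) : 0 < orient a b z := by
  let L : Plane →L[ℝ] ℝ := (b 0 - a 0) • (EuclideanSpace.proj 1 : Plane →L[ℝ] ℝ) -
    (b 1 - a 1) • (EuclideanSpace.proj 0 : Plane →L[ℝ] ℝ)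
  have hL : ∀ x, orient a b x = L x + orient a b 0 := by
    intro x; simp [orient, L]; ring
  have hsurj : Function.Surjective L := by
    have hd : (b 0 - a 0) ^ 2 + (b 1 - a 1) ^ 2 ≠ 0 := by
      intro h
      apply hab
      have h0 : (b 0 - a 0) ^ 2 = 0 := by nlinarith [sq_nonneg (b 0 - a 0), sq_nonneg (b 1 - a 1)]
      have h1 : (b 1 - a 1) ^ 2 = 0 := by nlinarith [sq_nonneg (b 0 - a 0), sq_nonneg (b 1 - a 1)]
      apply plane_ext
      · linarith [pow_eq_zero_iff (two_ne_zero) |>.1 h0]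
      · linarith [pow_eq_zero_iff (two_ne_zero) |>.1 h1]
    intro t
    refine ⟨(t / ((b 0 - a 0) ^ 2 + (b 1 - a 1) ^ 2)) • !₂[-(b 1 - a 1), b 0 - a 0], ?_⟩
    simp [L]
    field_simp
    ring
  have hopen : IsOpen (L '' interior S) := (L.isOpenMap hsurj) _ isOpen_interior
  have hsub : L '' interior S ⊆ interior (Set.Ici (-orient a b 0)) := by
    refine interior_maximal ?_ hopen
    rintro _ ⟨x, hx, rfl⟩
    have := hS x (interior_subset hx)
    rw [hL] at this
    simp only [Set.mem_Ici]; linarith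
  have := hsub ⟨z, hz, rfl⟩
  rw [interior_Ici, Set.mem_Ioi] at this
  rw [hL]; linarith

theorem orient_pos_of_mem_interior_triangle {p : Fin 3 → Plane}
    (h : 0 < orient (p 0) (p 1) (p 2)) {z : Plane}
    (hz : z ∈ interior (convexHull ℝ (Set.range p))) :
    0 < orient (p 0) (p 1) z ∧ 0 < orient (p 1) (p 2) z ∧ 0 < orient (p 2) (p 0) z := by
  have e0 : ∀ a b, orient a b a = 0 := by intro a b; simp [orient]
  have e1 : ∀ a b, orient a b b = 0 := by intro a b; simp [orient]; ring
  have c1 : orient (p 1) (p 2) (p 0) = orient (p 0) (p 1) (p 2) := by unfold orient; ring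
  have c2 : orient (p 2) (p 0) (p 1) = orient (p 0) (p 1) (p 2) := by unfold orient; ring
  have ne : ∀ a b c, 0 < orient a b c → a ≠ b := by
    rintro a b c h rfl; simp [orient] at h
  refine ⟨?_, ?_, ?_⟩
  · refine orient_pos_of_mem_interior (ne _ _ _ h) (fun x hx => ?_) hz
    refine orient_nonneg_of_mem_triangle hx fun i => ?_
    fin_cases i <;> simp [e0, e1, h.le]
  · refine orient_pos_of_mem_interior (ne _ _ (p 0) (by rwa [c1])) (fun x hx => ?_) hz
    refine orient_nonneg_of_mem_triangle hx fun i => ?_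
    fin_cases i <;> simp [e0, e1, c1, h.le]
  · refine orient_pos_of_mem_interior (ne _ _ (p 1) (by rwa [c2])) (fun x hx => ?_) hz
    refine orient_nonneg_of_mem_triangle hx fun i => ?_
    fin_cases i <;> simp [e0, e1, c2, h.le]

theorem affineIndependent_of_orient_ne_zero {p : Fin 3 → Plane}
    (h : orient (p 0) (p 1) (p 2) ≠ 0) : AffineIndependent ℝ p := by
  rw [affineIndependent_iff_of_fintype]
  intro w hw hv
  rw [Finset.univ.weightedVSub_eq_linear_combination hw] at hv
  have hx := congrArg (fun v : Plane => v 0) hv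
  have hy := congrArg (fun v : Plane => v 1) hv
  simp only [Fin.sum_univ_three, PiLp.add_apply, PiLp.smul_apply, smul_eq_mul,
    PiLp.zero_apply] at hw hx hy
  have h0 : w 0 = -w 1 - w 2 := by linarith
  rw [h0] at hx hy
  have h1 : w 1 * orient (p 0) (p 1) (p 2) = 0 := by
    unfold orient
    linear_combination (p 2 1 - p 0 1) * hx - (p 2 0 - p 0 0) * hy
  have h2 : w 2 * orient (p 0) (p 1) (p 2) = 0 := by
    unfold orient
    linear_combination (p 1 0 - p 0 0) * hy - (p 1 1 - p 0 1) * hx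
  have w1 := (mul_eq_zero.1 h1).resolve_right h
  have w2 := (mul_eq_zero.1 h2).resolve_right h
  intro i
  fin_cases i
  · simp [h0, w1, w2]
  · exact w1
  · exact w2

/-! ### A congruence invariant of triangles. -/

theorem extremePoints_triangle {p : Fin 3 → Plane} (h : AffineIndependent ℝ p) :
    (convexHull ℝ (Set.range p)).extremePoints ℝ = Set.range p := by
  refine Set.Subset.antisymm extremePoints_convexHull_subset ?_
  rintro _ ⟨k, rfl⟩
  rw [mem_extremePoints_iff_left]
  refine ⟨subset_convexHull ℝ _ ⟨k, rfl⟩, ?_⟩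
  intro x hx y hy hxy
  obtain ⟨f, hf, hfs, rfl⟩ := mem_convexHull_range_three.1 hx
  obtain ⟨g, hg, hgs, rfl⟩ := mem_convexHull_range_three.1 hy
  obtain ⟨a, b, ha, hb, hab, hk⟩ := hxy
  rw [affineIndependent_iff] at h
  have key := h Finset.univ (fun i => a * f i + b * g i - (Pi.single k 1 : Fin 3 → ℝ) i)
    (by rw [Finset.sum_sub_distrib, Finset.sum_add_distrib, ← Finset.mul_sum, ← Finset.mul_sum,
          hfs, hgs]; simp [hab])
    (by
      simp only [sub_smul, add_smul, mul_smul, Finset.sum_sub_distrib, Finset.sum_add_distrib,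
        ← Finset.smul_sum, hk]
      simp [Pi.single_apply])
  have hz : ∀ i, i ≠ k → f i = 0 := by
    intro i hi
    have := key i (Finset.mem_univ i)
    simp only [Pi.single_apply, if_neg hi, sub_zero] at this
    have h1 := mul_nonneg ha.le (hf i)
    have h2 := mul_nonneg hb.le (hg i)
    have h3 : a * f i = 0 := by linarith
    exact (mul_eq_zero.1 h3).resolve_left ha.ne'
  have hfk : f k = 1 := by
    rw [← hfs]; exact (Finset.sum_eq_single k (fun i _ hi => hz i hi) (by simp)).symm
  rw [Finset.sum_eq_single k (fun i _ hi => by rw [hz i hi, zero_smul]) (by simp), hfk, one_smul]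

/-- The sum of the squares of the side lengths. -/
noncomputable def sumSqSides (p : Fin 3 → Plane) : ℝ :=
  dist (p 0) (p 1) ^ 2 + dist (p 1) (p 2) ^ 2 + dist (p 2) (p 0) ^ 2

/-- The sum over ordered pairs is visibly invariant under relabelling the vertices. -/
theorem sumSqSides_eq (p : Fin 3 → Plane) :
    sumSqSides p = (∑ i, ∑ j, dist (p i) (p j) ^ 2) / 2 := by
  simp only [Fin.sum_univ_three, sumSqSides, dist_self, dist_comm (p 1) (p 0),
    dist_comm (p 2) (p 1), dist_comm (p 0) (p 2)]
  ring

/-- A surjective isometry is affine (Mazur–Ulam), so it carries extreme points to extreme points and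
permutes the vertices. -/
theorem AreCongruent.sumSqSides_eq {p q : Fin 3 → Plane} (hp : AffineIndependent ℝ p)
    (hq : AffineIndependent ℝ q)
    (h : AreCongruent (convexHull ℝ (Set.range p)) (convexHull ℝ (Set.range q))) :
    sumSqSides p = sumSqSides q := by
  obtain ⟨f, hf⟩ := h
  let g := f.toRealAffineIsometryEquiv
  have hg : ⇑g = f := f.coeFn_toRealAffineIsometryEquiv
  have hfp : AffineIndependent ℝ (f ∘ p) := by
    rw [← hg]
    exact (AffineEquiv.affineIndependent_iff g.toAffineEquiv).2 hp
  have him : f '' convexHull ℝ (Set.range p) = convexHull ℝ (Set.range (f ∘ p)) := by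
    rw [Set.range_comp, ← hg]
    exact g.toAffineEquiv.toAffineMap.image_convexHull _
  have hr : Set.range (f ∘ p) = Set.range q := by
    rw [← extremePoints_triangle hfp, ← extremePoints_triangle hq, ← him, hf]
  have hσ : ∀ i, ∃ k, q k = f (p i) := fun i => by
    have : (f ∘ p) i ∈ Set.range q := hr ▸ ⟨i, rfl⟩
    exact this
  choose σ hσ using hσ
  have hinj : Function.Injective σ := by
    intro i j hij
    apply hfp.injective
    simp only [Function.comp_apply, ← hσ, hij]
  let e : Equiv.Perm (Fin 3) := Equiv.ofBijective σ (Finite.injective_iff_bijective.1 hinj)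
  rw [PlaneTiling.sumSqSides_eq, PlaneTiling.sumSqSides_eq]
  congr 1
  rw [← Equiv.sum_comp e fun k => ∑ l, dist (q k) (q l) ^ 2]
  refine Finset.sum_congr rfl fun i _ => ?_
  rw [← Equiv.sum_comp e fun l => dist (q (e i)) (q l) ^ 2]
  refine Finset.sum_congr rfl fun j _ => ?_
  change _ = dist (q (σ i)) (q (σ j)) ^ 2
  rw [hσ, hσ, f.dist_eq]

/-! ### Area of a triangle. -/

theorem volume_standard_triangle :
    volume {z : Plane | 0 ≤ z 0 ∧ 0 ≤ z 1 ∧ z 0 + z 1 ≤ 1} = ENNReal.ofReal (1 / 2) := by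
  have hp : MeasurePreserving (fun z : Plane => (z 0, z 1)) volume volume :=
    (volume_preserving_finTwoArrow ℝ).comp (PiLp.volume_preserving_ofLp (Fin 2))
  let S : Set (ℝ × ℝ) := {q | q.1 ∈ Set.Icc (0 : ℝ) 1 ∧ q.2 ∈ Set.Icc (0 : ℝ) (1 - q.1)}
  have hS : MeasurableSet S :=
    measurableSet_region_between_cc measurable_const (by fun_prop) measurableSet_Icc
  have hpre : {z : Plane | 0 ≤ z 0 ∧ 0 ≤ z 1 ∧ z 0 + z 1 ≤ 1} =
      (fun z : Plane => (z 0, z 1)) ⁻¹' S := by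
    ext z
    simp only [S, Set.mem_ofPred_eq, Set.mem_preimage, Set.mem_Icc]
    constructor
    · rintro ⟨h0, h1, h2⟩
      exact ⟨⟨h0, by linarith⟩, h1, by linarith⟩
    · rintro ⟨⟨h0, -⟩, h1, h2⟩
      exact ⟨h0, h1, by linarith⟩
  rw [hpre, hp.measure_preimage hS.nullMeasurableSet, Measure.volume_eq_prod,
    Measure.prod_apply hS]
  have hsec : ∀ x : ℝ, volume (Prod.mk x ⁻¹' S) =
      (Set.Icc (0 : ℝ) 1).indicator (fun x => ENNReal.ofReal (1 - x)) x := by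
    intro x
    by_cases hx : x ∈ Set.Icc (0 : ℝ) 1
    · rw [Set.indicator_of_mem hx]
      have : Prod.mk x ⁻¹' S = Set.Icc 0 (1 - x) := by
        ext y; simp only [S, Set.mem_preimage, Set.mem_ofPred_eq, hx, true_and]
      rw [this, Real.volume_Icc, sub_zero]
    · rw [Set.indicator_of_notMem hx]
      have : Prod.mk x ⁻¹' S = ∅ := by
        ext y; simp only [S, Set.mem_preimage, Set.mem_ofPred_eq, hx, false_and]; rfl
      rw [this, measure_empty]
  simp_rw [hsec]
  rw [lintegral_indicator measurableSet_Icc, ← ofReal_integral_eq_lintegral_ofReal]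
  · rw [integral_Icc_eq_integral_Ioc, ← intervalIntegral.integral_of_le zero_le_one]
    congr 1
    rw [intervalIntegral.integral_sub (by simp) (by simp)]
    simp; norm_num
  · exact (continuous_const.sub continuous_id).integrableOn_Icc
  · filter_upwards [ae_restrict_mem measurableSet_Icc] with x hx
    simpa using hx.2

theorem volume_triangle (p : Fin 3 → Plane) :
    volume (convexHull ℝ (Set.range p)) =
      ENNReal.ofReal (|orient (p 0) (p 1) (p 2)| / 2) := by
  let M : Matrix (Fin 2) (Fin 2) ℝ :=
    !![p 1 0 - p 0 0, p 2 0 - p 0 0; p 1 1 - p 0 1, p 2 1 - p 0 1]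
  let L : Plane →ₗ[ℝ] Plane := Matrix.toLin (PiLp.basisFun 2 ℝ (Fin 2)) (PiLp.basisFun 2 ℝ (Fin 2)) M
  have hL : ∀ z : Plane, L z = z 0 • (p 1 - p 0) + z 1 • (p 2 - p 0) := by
    intro z
    have h : ∀ i, L z i = M.mulVec (fun k => z k) i := by
      intro i
      have := congrFun (LinearMap.toMatrix_mulVec_repr (PiLp.basisFun 2 ℝ (Fin 2))
        (PiLp.basisFun 2 ℝ (Fin 2)) L z) i
      simp only [L, LinearMap.toMatrix_toLin] at this
      simpa using this.symm
    apply plane_ext <;> rw [h] <;>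
      simp [M, Matrix.mulVec, dotProduct, Fin.sum_univ_two] <;> ring
  have hdet : LinearMap.det L = orient (p 0) (p 1) (p 2) := by
    simp only [L, LinearMap.det_toLin, M, Matrix.det_fin_two_of, orient]; ring
  have himg : convexHull ℝ (Set.range p) =
      (fun z => p 0 + z) '' (L '' {z : Plane | 0 ≤ z 0 ∧ 0 ≤ z 1 ∧ z 0 + z 1 ≤ 1}) := by
    ext x
    rw [mem_convexHull_range_three, ← Set.image_comp]
    simp only [Set.mem_image, Set.mem_ofPred_eq, Function.comp_apply, hL]
    constructor
    · rintro ⟨f, hf, hs, rfl⟩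
      refine ⟨!₂[f 1, f 2], ⟨hf 1, hf 2, ?_⟩, ?_⟩
      · simp only [Fin.sum_univ_three] at hs
        have := hf 0
        simp; linarith
      · simp only [Fin.sum_univ_three] at hs ⊢
        have : f 0 = 1 - f 1 - f 2 := by linarith
        rw [this]
        simp
        module
    · rintro ⟨z, ⟨h0, h1, h2⟩, rfl⟩
      refine ⟨![1 - z 0 - z 1, z 0, z 1], ?_, ?_, ?_⟩
      · intro i; fin_cases i <;> simp <;> linarith
      · simp only [Fin.sum_univ_three, Matrix.cons_val]; ring
      · simp only [Fin.sum_univ_three, Matrix.cons_val]; module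
  rw [himg, Set.image_add_left, measure_preimage_add, Measure.addHaar_image_linearMap, hdet,
    volume_standard_triangle, ← ENNReal.ofReal_mul (abs_nonneg _)]
  congr 1; ring

/-! ### Normality and bounded perimeter. -/

theorem abs_coord_sub_le_dist (x y : Plane) (i : Fin 2) : |x i - y i| ≤ dist x y := by
  rw [dist_eq_norm]
  exact PiLp.norm_apply_le (x - y) i

theorem dist_le_abs_add_abs (x y : Plane) : dist x y ≤ |x 0 - y 0| + |x 1 - y 1| := by
  rw [EuclideanSpace.dist_eq, Fin.sum_univ_two, Real.dist_eq, Real.dist_eq, sq_abs, sq_abs]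
  apply Real.sqrt_le_iff.2
  constructor
  · positivity
  · nlinarith [sq_abs (x 0 - y 0), sq_abs (x 1 - y 1), abs_nonneg (x 0 - y 0),
      abs_nonneg (x 1 - y 1)]

/-- A triangle of unit area with sides at most `c` contains a ball of radius `1 / (3 * c)`. -/
theorem exists_closedBall_subset_triangle {p : Fin 3 → Plane} {c : ℝ} (hc : 0 < c)
    (hv : volume (convexHull ℝ (Set.range p)) = 1) (hd : ∀ i j, dist (p i) (p j) ≤ c) :
    ∃ x, Metric.closedBall x (1 / (3 * c)) ⊆ convexHull ℝ (Set.range p) := by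
  rw [volume_triangle, ENNReal.ofReal_eq_one] at hv
  have hD : |orient (p 0) (p 1) (p 2)| = 2 := by linarith
  set D := orient (p 0) (p 1) (p 2) with hDdef
  have hD0 : D ≠ 0 := by intro h; rw [h] at hD; norm_num at hD
  set g : Plane := (1 / 3 : ℝ) • (p 0 + p 1 + p 2) with hg
  refine ⟨g, fun z hz => ?_⟩
  rw [Metric.mem_closedBall] at hz
  -- All barycentric coordinates equal 1/3 at the centroid `g`. These are their increments from `g`
  -- to `z`, of size at most `2 * c * (1 / (3 * c)) / 2 = 1 / 3`, so the coordinates stay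
  -- nonnegative.
  have hb : ∀ i j, |((p j 0 - p i 0) * (z 1 - g 1) - (p j 1 - p i 1) * (z 0 - g 0)) / D| ≤
      1 / 3 := by
    intro i j
    have a0 := (abs_coord_sub_le_dist (p j) (p i) 0).trans (hd j i)
    have a1 := (abs_coord_sub_le_dist (p j) (p i) 1).trans (hd j i)
    have b0 := (abs_coord_sub_le_dist z g 0).trans hz
    have b1 := (abs_coord_sub_le_dist z g 1).trans hz
    rw [abs_div, hD, div_le_iff₀ two_pos]
    calc _ ≤ |(p j 0 - p i 0) * (z 1 - g 1)| + |(p j 1 - p i 1) * (z 0 - g 0)| := abs_sub _ _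
      _ ≤ c * (1 / (3 * c)) + c * (1 / (3 * c)) := by
          rw [abs_mul, abs_mul]; gcongr
      _ = 1 / 3 * 2 := by field_simp; norm_num
  rw [mem_convexHull_range_three]
  have k0 := (abs_le.1 (hb 1 2)).1
  have k1 := (abs_le.1 (hb 2 0)).1
  have k2 := (abs_le.1 (hb 0 1)).1
  refine ⟨![1 / 3 + ((p 2 0 - p 1 0) * (z 1 - g 1) - (p 2 1 - p 1 1) * (z 0 - g 0)) / D,
    1 / 3 + ((p 0 0 - p 2 0) * (z 1 - g 1) - (p 0 1 - p 2 1) * (z 0 - g 0)) / D,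
    1 / 3 + ((p 1 0 - p 0 0) * (z 1 - g 1) - (p 1 1 - p 0 1) * (z 0 - g 0)) / D], ?_, ?_, ?_⟩
  · intro i; fin_cases i <;> simp <;> linarith
  · simp only [Fin.sum_univ_three, Matrix.cons_val]; field_simp; ring
  · have g0 : g 0 = 1 / 3 * (p 0 0 + p 1 0 + p 2 0) := by simp [hg]; ring
    have g1 : g 1 = 1 / 3 * (p 0 1 + p 1 1 + p 2 1) := by simp [hg]; ring
    apply plane_ext <;> simp only [Fin.sum_univ_three, Matrix.cons_val, PiLp.add_apply,
      PiLp.smul_apply, smul_eq_mul] <;> rw [g0, g1] <;> field_simp <;> rw [hDdef] <;>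
      unfold orient <;> ring

theorem isNormal_iff_exists_perimeter_le {𝒯 : Set (Set Plane)} (h : IsUnitTriangleTiling 𝒯) :
    IsNormal 𝒯 ↔ ∃ c : ℝ, ∀ T ∈ 𝒯, ∃ p : ℝ, HasPerimeter T p ∧ p ≤ c := by
  constructor
  · rintro ⟨r, R, -, -, hR⟩
    refine ⟨6 * R, fun T hT => ?_⟩
    obtain ⟨t, ht⟩ := (h.2 T hT).1
    obtain ⟨-, y, hy⟩ := hR T hT
    refine ⟨_, ⟨t, ht, rfl⟩, ?_⟩
    have hd : ∀ i j, dist (t.points i) (t.points j) ≤ 2 * R := by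
      have hm : ∀ i, dist (t.points i) y ≤ R := fun i =>
        hy (ht ▸ subset_convexHull ℝ _ ⟨i, rfl⟩)
      intro i j
      linarith [dist_triangle_right (t.points i) (t.points j) y, hm i, hm j]
    linarith [hd 0 1, hd 1 2, hd 2 0]
  · rintro ⟨c, hc⟩
    -- The maximum with 1 makes both radii positive and the inner one smaller than the outer.
    refine ⟨1 / (3 * max c 1), max c 1, by positivity, ?_, fun T hT => ?_⟩
    · have h1 := le_max_right c 1
      rw [div_lt_iff₀ (by positivity)]
      nlinarith
    · obtain ⟨p, ⟨t, ht, rfl⟩, hp⟩ := hc T hT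
      have n0 := @dist_nonneg _ _ (t.points 0) (t.points 1)
      have n1 := @dist_nonneg _ _ (t.points 1) (t.points 2)
      have n2 := @dist_nonneg _ _ (t.points 2) (t.points 0)
      have hcm := le_max_left c 1
      have hd : ∀ i j, dist (t.points i) (t.points j) ≤ max c 1 := by
        intro i j
        fin_cases i <;> fin_cases j <;> simp only [dist_self, Fin.zero_eta, Fin.mk_one,
          Fin.reduceFinMk, dist_comm (t.points 1) (t.points 0),
          dist_comm (t.points 2) (t.points 1), dist_comm (t.points 0) (t.points 2)] <;>
          linarith [le_max_right c 1]
      constructor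
      · rw [ht]
        exact exists_closedBall_subset_triangle (by positivity) (ht ▸ (h.2 T hT).2) hd
      · refine ⟨t.points 0, ?_⟩
        rw [ht]
        refine convexHull_min ?_ (convex_closedBall _ _)
        rintro _ ⟨i, rfl⟩
        exact hd i 0

/-! ### The dissection of a block. -/

/-- The larger root of `5 * x ^ 2 - 5 * x + 1`. -/
noncomputable def ω : ℝ := (5 + √5) / 10

theorem sqrt_five_eq : √5 = 10 * ω - 5 := by unfold ω; ring

theorem ω_sq : ω ^ 2 = ω - 1 / 5 := by
  have h := Real.sq_sqrt (show (0 : ℝ) ≤ 5 by norm_num)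
  rw [sqrt_five_eq] at h
  linarith

theorem ω_bounds : 0.72 < ω ∧ ω < 0.73 := by
  have h1 : (2.2 : ℝ) < √5 := Real.lt_sqrt_of_sq_lt (by norm_num)
  have h2 : √5 < (2.3 : ℝ) := (Real.sqrt_lt' (by norm_num)).2 (by norm_num)
  rw [sqrt_five_eq] at h1 h2
  constructor <;> linarith

/-- Twice the signed area of a triangle in block coordinates. -/
def cross (a b z : ℝ × ℝ) : ℝ := (b.1 - a.1) * (z.2 - a.2) - (b.2 - a.2) * (z.1 - a.1)

/-- The eight prototiles of a block. The first five dissect a trapezoid with vertices `(0, 0)`,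
`(5 - 5 * ω, 0)`, `(5 * ω, 1)`, `(0, 1)`, the others form a fan with apex `(5 * ω, 1)`. -/
noncomputable def proto : Fin 8 → Fin 3 → ℝ × ℝ :=
  ![![(0, 0), (5 - 5 * ω, 0), (0, ω)],
    ![(0, ω), (5 - 5 * ω, 0), ((10 - 5 * ω) / 3, 1 / 3)],
    ![(0, ω), ((10 - 5 * ω) / 3, 1 / 3), ((5 + 5 * ω) / 3, 2 / 3)],
    ![(0, ω), ((5 + 5 * ω) / 3, 2 / 3), (5 * ω, 1)],
    ![(0, ω), (5 * ω, 1), (0, 1)],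
    ![(5 - 5 * ω, 0), (6 - 5 * ω, 0), (5 * ω, 1)],
    ![(6 - 5 * ω, 0), (7 - 5 * ω, 0), (5 * ω, 1)],
    ![(7 - 5 * ω, 0), (8 - 5 * ω, 0), (5 * ω, 1)]]

/-- The equation for `ω` says `(5 - 5 * ω) * ω = 1`, which settles the triangles 0 and 4 at the two
ends of the left side. The triangles 1, 2, 3 share the apex `(0, ω)` over the trisected slanted leg,
so they split the remaining 3 of the total 5 equally. -/
theorem cross_proto (i : Fin 8) : cross (proto i 0) (proto i 1) (proto i 2) = 1 := by
  have h := ω_sq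
  fin_cases i <;> simp [proto, cross] <;> ring_nf <;> linarith

/-- The point with block coordinates `q` lies in the prototile `i`. -/
def InProto (i : Fin 8) (q : ℝ × ℝ) : Prop :=
  0 ≤ cross (proto i 0) (proto i 1) q ∧ 0 ≤ cross (proto i 1) (proto i 2) q ∧
    0 ≤ cross (proto i 2) (proto i 0) q

/-- The point with block coordinates `q` lies in the interior of the prototile `i`. -/
def InProtoInterior (i : Fin 8) (q : ℝ × ℝ) : Prop :=
  0 < cross (proto i 0) (proto i 1) q ∧ 0 < cross (proto i 1) (proto i 2) q ∧
    0 < cross (proto i 2) (proto i 0) q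

/-- The slanted leg separates trapezoid from fan. Within each, the triangles are sectors around `(0,
ω)` or around `(5 * ω, 1)`, apart from 0 and 4, which lie beyond the outermost rays from `(0, ω)`.
-/
theorem exists_inProto {X Y n : ℝ} (hn : n = 2 ∨ n = 3) (hX : 0 ≤ X) (hY : 0 ≤ Y) (hY1 : Y ≤ 1)
    (hXn : X ≤ 5 - 5 * ω + n + (10 * ω - 5 - n) * Y) :
    ∃ i : Fin 8, (i = 7 → n = 3) ∧ InProto i (X, Y) := by
  obtain ⟨h1, h2⟩ := ω_bounds
  have hw := ω_sq
  have hwX : 0 ≤ ω * X := by positivity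
  have hwX' : 0 ≤ (1 - ω) * X := mul_nonneg (by linarith) hX
  have hwY : 0 ≤ (1 - ω) * Y := mul_nonneg (by linarith) hY
  have hwY1 : 0 ≤ ω * (1 - Y) := mul_nonneg (by linarith) (by linarith)
  rcases le_total 0 (cross (5 - 5 * ω, 0) (5 * ω, 1) (X, Y)) with hl | hl
  · rcases le_total (cross (0, ω) (5 - 5 * ω, 0) (X, Y)) 0 with a1 | a1
    · refine ⟨0, by simp, ?_⟩
      simp [InProto, proto, cross] at *
      refine ⟨?_, ?_, ?_⟩ <;> nlinarith
    rcases le_total (cross (0, ω) ((10 - 5 * ω) / 3, 1 / 3) (X, Y)) 0 with a2 | a2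
    · refine ⟨1, by simp, ?_⟩
      simp [InProto, proto, cross] at *
      refine ⟨?_, ?_, ?_⟩ <;> nlinarith
    rcases le_total (cross (0, ω) ((5 + 5 * ω) / 3, 2 / 3) (X, Y)) 0 with a3 | a3
    · refine ⟨2, by simp, ?_⟩
      simp [InProto, proto, cross] at *
      refine ⟨?_, ?_, ?_⟩ <;> nlinarith
    rcases le_total (cross (0, ω) (5 * ω, 1) (X, Y)) 0 with a4 | a4
    · refine ⟨3, by simp, ?_⟩
      simp [InProto, proto, cross] at *
      refine ⟨?_, ?_, ?_⟩ <;> nlinarith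
    · refine ⟨4, by simp, ?_⟩
      simp [InProto, proto, cross] at *
      refine ⟨?_, ?_, ?_⟩ <;> nlinarith
  · rcases le_total 0 (cross (6 - 5 * ω, 0) (5 * ω, 1) (X, Y)) with a1 | a1
    · refine ⟨5, by simp, ?_⟩
      simp [InProto, proto, cross] at *
      refine ⟨?_, ?_, ?_⟩ <;> nlinarith
    rcases le_total 0 (cross (7 - 5 * ω, 0) (5 * ω, 1) (X, Y)) with a2 | a2
    · refine ⟨6, by simp, ?_⟩
      simp [InProto, proto, cross] at *
      refine ⟨?_, ?_, ?_⟩ <;> nlinarith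
    have key : n = 3 → InProto 7 (X, Y) := by
      rintro rfl
      simp [InProto, proto, cross] at *
      refine ⟨?_, ?_, ?_⟩ <;> nlinarith
    rcases hn with rfl | rfl
    -- For `n = 2` the line in `a2` is the right side of the block, so the point lies on it, an edge
    -- of triangle 6.
    · refine ⟨6, by simp, ?_⟩
      simp [InProto, proto, cross] at *
      refine ⟨?_, ?_, ?_⟩ <;> nlinarith
    · exact ⟨7, by simp, key rfl⟩

/-- As the whole triangle has `cross` equal to 1, the three values of `cross` at `q` are its
barycentric coordinates, with no division. -/
theorem affine_eq_sum_cross (i : Fin 8) (q : ℝ × ℝ) (a b c : ℝ) : a * q.1 + b * q.2 + c =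
    cross (proto i 1) (proto i 2) q * (a * (proto i 0).1 + b * (proto i 0).2 + c) +
    cross (proto i 2) (proto i 0) q * (a * (proto i 1).1 + b * (proto i 1).2 + c) +
    cross (proto i 0) (proto i 1) q * (a * (proto i 2).1 + b * (proto i 2).2 + c) := by
  calc _ = cross (proto i 0) (proto i 1) (proto i 2) * (a * q.1 + b * q.2 + c) := by
        rw [cross_proto, one_mul]
    _ = _ := by unfold cross; ring

theorem InProtoInterior.affine_pos {i : Fin 8} {q : ℝ × ℝ} (h : InProtoInterior i q) {a b c : ℝ}
    (h0 : ∀ l, 0 ≤ a * (proto i l).1 + b * (proto i l).2 + c)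
    (h1 : ∃ l, 0 < a * (proto i l).1 + b * (proto i l).2 + c) : 0 < a * q.1 + b * q.2 + c := by
  obtain ⟨h2, h3, h4⟩ := h
  have k0 := mul_nonneg h3.le (h0 0)
  have k1 := mul_nonneg h4.le (h0 1)
  have k2 := mul_nonneg h2.le (h0 2)
  rw [affine_eq_sum_cross i]
  obtain ⟨l, hl⟩ := h1
  fin_cases l
  · have := mul_pos h3 hl
    dsimp at this; linarith
  · have := mul_pos h4 hl
    dsimp at this; linarith
  · have := mul_pos h2 hl
    dsimp at this; linarith

theorem InProtoInterior.bounds {i : Fin 8} {q : ℝ × ℝ} (h : InProtoInterior i q) :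
    0 < q.2 ∧ q.2 < 1 ∧ 0 < q.1 := by
  obtain ⟨h1, h2⟩ := ω_bounds
  have a1 := h.affine_pos (a := 0) (b := 1) (c := 0)
    (by intro l; fin_cases i <;> fin_cases l <;> simp [proto] <;> linarith)
    (by fin_cases i <;> exact ⟨2, by simp [proto]; try linarith⟩)
  have a2 := h.affine_pos (a := 0) (b := -1) (c := 1)
    (by intro l; fin_cases i <;> fin_cases l <;> simp [proto] <;> linarith)
    (by fin_cases i <;> exact ⟨0, by simp [proto]; try linarith⟩)
  have a3 := h.affine_pos (a := 1) (b := 0) (c := 0)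
    (by intro l; fin_cases i <;> fin_cases l <;> simp [proto] <;> linarith)
    (by fin_cases i <;> exact ⟨1, by simp [proto]; linarith⟩)
  refine ⟨?_, ?_, ?_⟩ <;> linarith

theorem InProtoInterior.fst_lt {i : Fin 8} {q : ℝ × ℝ} (h : InProtoInterior i q) {n : ℝ}
    (hn : 2 ≤ n) (hi : i = 7 → n = 3) :
    q.1 < 5 - 5 * ω + n + (10 * ω - 5 - n) * q.2 := by
  obtain ⟨h1, h2⟩ := ω_bounds
  have hw := ω_sq
  have a1 := h.affine_pos (a := -1) (b := 10 * ω - 5 - n) (c := 5 - 5 * ω + n)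
    (by
      intro l
      by_cases h7 : i = 7
      · have := hi h7
        subst h7 this
        fin_cases l <;> simp [proto] <;> linarith
      · fin_cases i <;> fin_cases l <;> simp [proto] at h7 ⊢ <;> nlinarith)
    ⟨0, by
      by_cases h7 : i = 7
      · have := hi h7
        subst h7 this
        simp [proto]; linarith
      · fin_cases i <;> simp [proto] at h7 ⊢ <;> nlinarith⟩
  linarith

/-- The prototiles are numbered so that one edge of `k` separates it from all earlier ones: the
first edge for `k ≤ 4`, the last edge for the fan. -/
theorem InProtoInterior.index_not_lt {i k : Fin 8} {q : ℝ × ℝ} (h : InProtoInterior i q)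
    (h' : InProtoInterior k q) : ¬ i < k := by
  intro hik
  obtain ⟨h1, h2⟩ := ω_bounds
  have hw := ω_sq
  obtain ⟨u, v, huv, hv⟩ : ∃ u v : ℝ × ℝ, 0 < cross u v q ∧
      ∀ l, cross u v (proto i l) ≤ 0 := by
    by_cases hk : k ≤ 4
    · refine ⟨_, _, h'.1, fun l => ?_⟩
      fin_cases k <;> fin_cases i <;> simp at hik hk <;> fin_cases l <;>
        simp [proto, cross] <;> nlinarith
    · refine ⟨_, _, h'.2.2, fun l => ?_⟩
      fin_cases k <;> fin_cases i <;> simp at hik hk <;> fin_cases l <;>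
        simp [proto, cross] <;> nlinarith
  have key := affine_eq_sum_cross i q (-(v.2 - u.2)) (v.1 - u.1)
    ((v.2 - u.2) * u.1 - (v.1 - u.1) * u.2)
  have e : ∀ z : ℝ × ℝ, -(v.2 - u.2) * z.1 + (v.1 - u.1) * z.2 +
      ((v.2 - u.2) * u.1 - (v.1 - u.1) * u.2) = cross u v z := fun z => by unfold cross; ring
  simp only [e] at key
  have k0 := mul_nonneg h.2.1.le (neg_nonneg.2 (hv 0))
  have k1 := mul_nonneg h.2.2.le (neg_nonneg.2 (hv 1))
  have k2 := mul_nonneg h.1.le (neg_nonneg.2 (hv 2))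
  linarith

theorem InProtoInterior.unique {i k : Fin 8} {q : ℝ × ℝ} (h : InProtoInterior i q)
    (h' : InProtoInterior k q) : i = k :=
  le_antisymm (not_lt.1 (h'.index_not_lt h)) (not_lt.1 (h.index_not_lt h'))

/-! ### Laying out the blocks. -/

/-- Pairwise distinct rational numbers between `0` and `1`. -/
noncomputable def rowShift (j : ℤ) : ℝ := ((Encodable.encode j : ℝ) + 2)⁻¹

/-- The horizontal offset of the left side of block `p` in row `j`. -/
noncomputable def offset (j p : ℤ) : ℝ := Int.fract (rowShift j + p * √5)

/-- The number of tiles in the fan of block `p` in row `j`. -/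
noncomputable def fanSize (j p : ℤ) : ℝ := if 3 ≤ offset j p + √5 then 3 else 2

theorem fanSize_eq (j p : ℤ) : fanSize j p = 2 ∨ fanSize j p = 3 := by
  unfold fanSize; split_ifs <;> simp

theorem offset_nonneg (j p : ℤ) : 0 ≤ offset j p := Int.fract_nonneg _

theorem offset_lt_one (j p : ℤ) : offset j p < 1 := Int.fract_lt_one _

/-- Since `2 < √5 < 3`, `fanSize` is the integer part of `offset j p + √5`, and subtracting it
leaves the fractional part. -/
theorem offset_succ (j p : ℤ) : offset j (p + 1) = offset j p + √5 - fanSize j p := by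
  obtain ⟨h1, h2⟩ := ω_bounds
  have h0 := offset_nonneg j p
  have h3 := offset_lt_one j p
  have h5 := sqrt_five_eq
  have hs : rowShift j + (p : ℝ) * √5 = ⌊rowShift j + (p : ℝ) * √5⌋ + offset j p :=
    (Int.floor_add_fract _).symm
  obtain ⟨m, hm, hb⟩ : ∃ m : ℤ, fanSize j p = m ∧ (m : ℝ) ≤ offset j p + √5 ∧
      offset j p + √5 < m + 1 := by
    unfold fanSize
    split_ifs with h
    · exact ⟨3, by simp, by push_cast; linarith, by push_cast; linarith⟩
    · exact ⟨2, by simp, by push_cast; linarith, by push_cast; linarith⟩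
  rw [hm]
  conv_lhs => unfold offset
  rw [Int.fract_eq_iff]
  refine ⟨by linarith, by linarith, ⌊rowShift j + (p : ℝ) * √5⌋ + m, ?_⟩
  push_cast
  linarith

/-- For `p ≠ p'` a nonzero integer multiple of `√5` would be rational. For `p = p'` the row shifts
would differ by an integer, which is 0 since they lie strictly between 0 and 1. -/
theorem offset_injective {j p j' p' : ℤ} (h : offset j p = offset j' p') : j = j' ∧ p = p' := by
  obtain ⟨m, hm⟩ := Int.fract_eq_fract.1 h
  have hp : p = p' := by
    by_contra hne
    have hirr : Irrational (((p - p' : ℤ) : ℝ) * √5) :=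
      (Nat.Prime.irrational_sqrt (p := 5) (by norm_num)).intCast_mul (sub_ne_zero.2 hne)
    apply hirr
    refine ⟨m - ((Encodable.encode j : ℚ) + 2)⁻¹ + ((Encodable.encode j' : ℚ) + 2)⁻¹, ?_⟩
    unfold rowShift at hm
    push_cast
    linarith
  subst hp
  refine ⟨?_, rfl⟩
  have hr : ∀ k : ℤ, 0 < rowShift k ∧ rowShift k < 1 := by
    intro k
    unfold rowShift
    refine ⟨by positivity, inv_lt_one_of_one_lt₀ ?_⟩
    have : (0 : ℝ) ≤ Encodable.encode k := Nat.cast_nonneg _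
    linarith
  have h1 := hr j
  have h2 := hr j'
  have hm' : rowShift j - rowShift j' = m := by linarith
  have hm1 : m < 1 := by exact_mod_cast (by linarith : (m : ℝ) < 1)
  have hm2 : -1 < m := by exact_mod_cast (by linarith : (-1 : ℝ) < m)
  have hm0 : m = 0 := by omega
  rw [hm0, Int.cast_zero, sub_eq_zero] at hm'
  unfold rowShift at hm'
  have := inv_injective hm'
  have h3 : (Encodable.encode j : ℝ) = Encodable.encode j' := by linarith
  exact Encodable.encode_injective (by exact_mod_cast h3)

/-- The point of the plane with coordinates `q` in block `p` of row `j`. -/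
noncomputable def place (μ : ℝ) (j p : ℤ) (q : ℝ × ℝ) : Plane :=
  !₂[q.1 + (5 * ω * p - offset j p) + (offset j p + μ) * q.2, 2 * (q.2 + j)]

/-- The coordinates of a point of the plane with respect to block `p` of row `j`. -/
noncomputable def blockCoord (μ : ℝ) (j p : ℤ) (z : Plane) : ℝ × ℝ :=
  (z 0 - (5 * ω * p - offset j p) - (offset j p + μ) * (z 1 / 2 - j), z 1 / 2 - j)

theorem place_blockCoord (μ : ℝ) (j p : ℤ) (z : Plane) :
    place μ j p (blockCoord μ j p z) = z := by
  apply plane_ext <;> simp [place, blockCoord] <;> ring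

/-- Placement is a horizontal shear, a vertical stretch by 2 and a translation, so its determinant
is 2. -/
theorem orient_place (μ : ℝ) (j p : ℤ) (a b q : ℝ × ℝ) :
    orient (place μ j p a) (place μ j p b) (place μ j p q) = 2 * cross a b q := by
  simp [orient, place, cross]; ring

theorem orient_place_eq (μ : ℝ) (j p : ℤ) (a b : ℝ × ℝ) (z : Plane) :
    orient (place μ j p a) (place μ j p b) z = 2 * cross a b (blockCoord μ j p z) := by
  rw [← orient_place μ j p, place_blockCoord]

/-- The vertices of the copy of prototile `i` in block `p` of row `j`. -/
noncomputable def vertices (μ : ℝ) (j p : ℤ) (i : Fin 8) (k : Fin 3) : Plane :=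
  place μ j p (proto i k)

theorem orient_vertices (μ : ℝ) (j p : ℤ) (i : Fin 8) :
    orient (vertices μ j p i 0) (vertices μ j p i 1) (vertices μ j p i 2) = 2 := by
  simp only [vertices, orient_place, cross_proto, mul_one]

/-- The tiling, depending on a shear parameter. -/
def tiles (μ : ℝ) : Set (Set Plane) :=
  {T | ∃ j p : ℤ, ∃ i : Fin 8, (i = 7 → fanSize j p = 3) ∧
    T = convexHull ℝ (Set.range (vertices μ j p i))}

theorem mem_tile_of_inProto {μ : ℝ} {j p : ℤ} {i : Fin 8} {z : Plane}
    (h : InProto i (blockCoord μ j p z)) : z ∈ convexHull ℝ (Set.range (vertices μ j p i)) := by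
  obtain ⟨h0, h1, h2⟩ := h
  apply mem_triangle_of_orient_nonneg
  · rw [orient_vertices]; norm_num
  all_goals
    simp only [vertices, orient_place_eq]
    linarith

theorem inProtoInterior_of_mem_interior {μ : ℝ} {j p : ℤ} {i : Fin 8} {z : Plane}
    (h : z ∈ interior (convexHull ℝ (Set.range (vertices μ j p i)))) :
    InProtoInterior i (blockCoord μ j p z) := by
  have := orient_pos_of_mem_interior_triangle (by rw [orient_vertices]; norm_num) h
  simp only [vertices, orient_place_eq] at this
  obtain ⟨h0, h1, h2⟩ := this
  exact ⟨by linarith, by linarith, by linarith⟩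

/-- The right side of a block is the left side of the next one. -/
theorem blockCoord_succ_fst (μ : ℝ) (j p : ℤ) (z : Plane) :
    (blockCoord μ j (p + 1) z).1 = (blockCoord μ j p z).1 -
      (5 - 5 * ω + fanSize j p + (10 * ω - 5 - fanSize j p) * (blockCoord μ j p z).2) := by
  simp only [blockCoord, offset_succ, sqrt_five_eq]
  push_cast; ring

/-- Successive values differ by the width of a block at the height of `z`, which lies between its
positive bottom and top lengths. -/
theorem blockCoord_fst_strictAnti {μ : ℝ} {j : ℤ} {z : Plane} (h0 : 0 ≤ z 1 / 2 - j)
    (h1 : z 1 / 2 - j ≤ 1) : StrictAnti fun p => (blockCoord μ j p z).1 := by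
  refine strictAnti_int_of_succ_lt fun p => ?_
  rw [blockCoord_succ_fst]
  obtain ⟨hw, hw'⟩ := ω_bounds
  change _ - (_ + _ * (z 1 / 2 - j)) < _
  rcases fanSize_eq j p with h | h <;> rw [h] <;> nlinarith

theorem sUnion_tiles (μ : ℝ) : ⋃₀ tiles μ = Set.univ := by
  refine Set.eq_univ_of_forall fun z => ?_
  obtain ⟨hw, hw'⟩ := ω_bounds
  set j := ⌊z 1 / 2⌋ with hj
  have h0 : 0 ≤ z 1 / 2 - j := by linarith [Int.floor_le (z 1 / 2)]
  have h1 : z 1 / 2 - j ≤ 1 := by linarith [Int.lt_floor_add_one (z 1 / 2)]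
  have hv : ∀ p : ℤ, (blockCoord μ j p z).1 =
      (z 0 - μ * (z 1 / 2 - j)) - 5 * ω * p + offset j p * (1 - (z 1 / 2 - j)) := by
    intro p; simp only [blockCoord]; ring
  obtain ⟨p, hp0, hp1⟩ : ∃ p : ℤ, 0 ≤ (blockCoord μ j p z).1 ∧
      (blockCoord μ j (p + 1) z).1 ≤ 0 := by
    set x := z 0 - μ * (z 1 / 2 - j) with hx
    have hpos : 0 < 5 * ω := by linarith
    have hf0 : 5 * ω * ⌊x / (5 * ω)⌋ ≤ x := by
      have := Int.floor_le (x / (5 * ω))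
      rwa [le_div_iff₀ hpos, mul_comm] at this
    have hf1 : x < 5 * ω * (⌊x / (5 * ω)⌋ + 1) := by
      have := Int.lt_floor_add_one (x / (5 * ω))
      rwa [div_lt_iff₀ hpos, mul_comm] at this
    have hoff : ∀ p, 0 ≤ offset j p * (1 - (z 1 / 2 - j)) ∧
        offset j p * (1 - (z 1 / 2 - j)) ≤ 1 := fun p =>
      ⟨mul_nonneg (offset_nonneg j p) (by linarith),
        mul_le_one₀ (offset_lt_one j p).le (by linarith) (by linarith)⟩
    -- Left sides deviate from an arithmetic progression of step `5 * ω` by at most 1, to the left.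
    -- Hence the block is the one given by the floor or the next.
    rcases le_total (blockCoord μ j (⌊x / (5 * ω)⌋ + 1) z).1 0 with h | h
    · refine ⟨_, ?_, h⟩
      rw [hv]; linarith [(hoff ⌊x / (5 * ω)⌋).1]
    · refine ⟨_, h, ?_⟩
      rw [hv]; push_cast
      linarith [(hoff (⌊x / (5 * ω)⌋ + 1 + 1)).2]
  rw [blockCoord_succ_fst] at hp1
  obtain ⟨i, hi, hq⟩ := exists_inProto (Y := (blockCoord μ j p z).2) (fanSize_eq j p) hp0 h0 h1
    (by linarith)
  exact ⟨_, ⟨j, p, i, hi, rfl⟩, mem_tile_of_inProto hq⟩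

theorem index_unique_of_mem_interior {μ : ℝ} {j p j' p' : ℤ} {i i' : Fin 8} {z : Plane}
    (hi : i = 7 → fanSize j p = 3) (hi' : i' = 7 → fanSize j' p' = 3)
    (h : z ∈ interior (convexHull ℝ (Set.range (vertices μ j p i))))
    (h' : z ∈ interior (convexHull ℝ (Set.range (vertices μ j' p' i')))) :
    j = j' ∧ p = p' ∧ i = i' := by
  replace h := inProtoInterior_of_mem_interior h
  replace h' := inProtoInterior_of_mem_interior h'
  have two_le : ∀ j p, 2 ≤ fanSize j p := fun j p => by
    rcases fanSize_eq j p with e | e <;> rw [e]; norm_num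
  obtain ⟨y0, y1, x0⟩ := h.bounds
  obtain ⟨y0', y1', x0'⟩ := h'.bounds
  have hj : j = j' := by
    simp only [blockCoord] at y0 y1 y0' y1'
    have e1 : (j : ℝ) < j' + 1 := by linarith
    have e2 : (j' : ℝ) < j + 1 := by linarith
    have e1' : j < j' + 1 := by exact_mod_cast e1
    have e2' : j' < j + 1 := by exact_mod_cast e2
    omega
  subst hj
  have hanti := blockCoord_fst_strictAnti (μ := μ) y0.le y1.le
  have r : (blockCoord μ j (p + 1) z).1 < 0 := by
    rw [blockCoord_succ_fst]; linarith [h.fst_lt (two_le j p) hi]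
  have r' : (blockCoord μ j (p' + 1) z).1 < 0 := by
    rw [blockCoord_succ_fst]; linarith [h'.fst_lt (two_le j p') hi']
  -- The point is right of the left side of either block and left of the left side of its successor;
  -- by monotonicity `p' < p + 1` and `p < p' + 1`.
  have hp : p = p' := by
    have e1 := hanti.lt_iff_gt.1 (r.trans x0')
    have e2 := hanti.lt_iff_gt.1 (r'.trans x0)
    omega
  subst hp
  exact ⟨rfl, rfl, h.unique h'⟩

theorem countable_tiles (μ : ℝ) : (tiles μ).Countable := by
  refine (Set.countable_range fun x : ℤ × ℤ × Fin 8 =>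
    convexHull ℝ (Set.range (vertices μ x.1 x.2.1 x.2.2))).mono ?_
  rintro _ ⟨j, p, i, -, rfl⟩
  exact ⟨(j, p, i), rfl⟩

theorem affineIndependent_vertices (μ : ℝ) (j p : ℤ) (i : Fin 8) :
    AffineIndependent ℝ (vertices μ j p i) :=
  affineIndependent_of_orient_ne_zero (by rw [orient_vertices]; norm_num)

theorem isUnitTriangleTiling_tiles (μ : ℝ) : IsUnitTriangleTiling (tiles μ) := by
  refine ⟨⟨countable_tiles μ, ?_, ?_, sUnion_tiles μ⟩, ?_⟩
  · rintro _ ⟨j, p, i, -, rfl⟩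
    exact (Set.finite_range _).isCompact_convexHull (𝕜 := ℝ)
  · rintro _ ⟨j, p, i, hi, rfl⟩ _ ⟨j', p', i', hi', rfl⟩ hne
    rw [Set.disjoint_left]
    intro z hz hz'
    obtain ⟨rfl, rfl, rfl⟩ := index_unique_of_mem_interior hi hi' hz hz'
    exact hne rfl
  · rintro _ ⟨j, p, i, -, rfl⟩
    refine ⟨⟨⟨_, affineIndependent_vertices μ j p i⟩, rfl⟩, ?_⟩
    rw [volume_triangle, orient_vertices]
    norm_num

theorem exists_perimeter_lt {μ : ℝ} (h0 : 0 < μ) (h1 : μ < 1) {T : Set Plane} (hT : T ∈ tiles μ) :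
    ∃ c : ℝ, HasPerimeter T c ∧ c < 100 := by
  obtain ⟨j, p, i, -, rfl⟩ := hT
  refine ⟨_, ⟨⟨_, affineIndependent_vertices μ j p i⟩, rfl, rfl⟩, ?_⟩
  obtain ⟨hw, hw'⟩ := ω_bounds
  have hs0 := offset_nonneg j p
  have hs1 := offset_lt_one j p
  have hb : ∀ k, 0 ≤ (proto i k).1 ∧ (proto i k).1 ≤ 5 ∧ 0 ≤ (proto i k).2 ∧
      (proto i k).2 ≤ 1 := by
    intro k
    fin_cases i <;> fin_cases k <;> refine ⟨?_, ?_, ?_, ?_⟩ <;> simp [proto] <;> linarith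
  -- Horizontally, at most 5 in block coordinates and at most `offset j p + μ < 2` from the slant;
  -- vertically, at most 2.
  have hd : ∀ k l, dist (vertices μ j p i k) (vertices μ j p i l) ≤ 9 := by
    intro k l
    refine (dist_le_abs_add_abs _ _).trans ?_
    obtain ⟨a1, a2, a3, a4⟩ := hb k
    obtain ⟨b1, b2, b3, b4⟩ := hb l
    have hx : |vertices μ j p i k 0 - vertices μ j p i l 0| ≤ 7 := by
      have e : vertices μ j p i k 0 - vertices μ j p i l 0 = ((proto i k).1 - (proto i l).1) +
          (offset j p + μ) * ((proto i k).2 - (proto i l).2) := by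
        simp [vertices, place]; ring
      rw [e, abs_le]
      constructor <;> nlinarith
    have hy : |vertices μ j p i k 1 - vertices μ j p i l 1| ≤ 2 := by
      have e : vertices μ j p i k 1 - vertices μ j p i l 1 =
          2 * ((proto i k).2 - (proto i l).2) := by
        simp [vertices, place]; ring
      rw [e, abs_le]
      constructor <;> linarith
    linarith
  have := hd 0 1
  have := hd 1 2
  have := hd 2 0
  dsimp only
  linarith

/-! ### Separating the tiles by a generic shear. -/

/-- The sum of the squares of the vertical components of the sides of a prototile. -/
noncomputable def verticalMoment (i : Fin 8) : ℝ :=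
  ((proto i 0).2 - (proto i 1).2) ^ 2 + ((proto i 1).2 - (proto i 2).2) ^ 2 +
    ((proto i 2).2 - (proto i 0).2) ^ 2

/-- The sum of the products of the components of the sides of a prototile. -/
noncomputable def mixedMoment (i : Fin 8) : ℝ :=
  ((proto i 0).1 - (proto i 1).1) * ((proto i 0).2 - (proto i 1).2) +
    ((proto i 1).1 - (proto i 2).1) * ((proto i 1).2 - (proto i 2).2) +
    ((proto i 2).1 - (proto i 0).1) * ((proto i 2).2 - (proto i 0).2)

theorem dist_sq_eq (x y : Plane) : dist x y ^ 2 = (x 0 - y 0) ^ 2 + (x 1 - y 1) ^ 2 := by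
  rw [EuclideanSpace.dist_eq, Real.sq_sqrt (by positivity), Fin.sum_univ_two, Real.dist_eq,
    Real.dist_eq, sq_abs, sq_abs]

/-- The slant adds `offset j p + μ` times the vertical component to the horizontal component of each
side; the offset thus enters the linear coefficient in `μ`. -/
theorem sumSqSides_vertices (μ : ℝ) (j p : ℤ) (i : Fin 8) :
    sumSqSides (vertices μ j p i) = sumSqSides (vertices 0 j p i) +
      2 * (mixedMoment i + offset j p * verticalMoment i) * μ + verticalMoment i * μ ^ 2 := by
  simp only [sumSqSides, dist_sq_eq, vertices, place, mixedMoment, verticalMoment]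
  simp
  ring

theorem verticalMoment_eq (i : Fin 8) : verticalMoment i =
    ![2 * ω - 2 / 5, 4 / 3 * ω - 8 / 45, 4 / 15, 52 / 45 - 4 / 3 * ω, 8 / 5 - 2 * ω, 2, 2, 2] i := by
  have h := ω_sq
  fin_cases i <;> simp [verticalMoment, proto] <;> ring_nf <;> linarith

theorem verticalMoment_pos (i : Fin 8) : 0 < verticalMoment i := by
  obtain ⟨h1, h2⟩ := ω_bounds
  rw [verticalMoment_eq]
  fin_cases i <;> simp <;> linarith

/-- All fan triangles have the same heights of vertices, so this coefficient cannot tell them apart.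
-/
theorem eq_or_of_verticalMoment_eq {i k : Fin 8} (h : verticalMoment i = verticalMoment k) :
    i = k ∨ 5 ≤ i ∧ 5 ≤ k := by
  obtain ⟨h1, h2⟩ := ω_bounds
  rw [verticalMoment_eq, verticalMoment_eq] at h
  fin_cases i <;> fin_cases k <;> simp at h ⊢ <;> linarith

theorem index_eq_of_moments_eq {j p j' p' : ℤ} {i i' : Fin 8}
    (h : verticalMoment i = verticalMoment i')
    (h' : mixedMoment i + offset j p * verticalMoment i =
      mixedMoment i' + offset j' p' * verticalMoment i') : j = j' ∧ p = p' ∧ i = i' := by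
  have hi : i = i' := by
    rcases eq_or_of_verticalMoment_eq h with rfl | ⟨h5, h5'⟩
    · rfl
    · have b1 := offset_nonneg j p
      have b2 := offset_nonneg j' p'
      have b3 := offset_lt_one j p
      have b4 := offset_lt_one j' p'
      rw [verticalMoment_eq, verticalMoment_eq] at h'
      -- Mixed moments of consecutive fan triangles differ by 2, whereas the terms `2 * offset`
      -- differ by less than 2.
      fin_cases i <;> fin_cases i' <;> simp [mixedMoment, proto] at h5 h5' h' ⊢ <;> linarith
  subst hi
  have hs : offset j p = offset j' p' :=
    mul_right_cancel₀ (verticalMoment_pos i).ne' (by linarith)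
  obtain ⟨rfl, rfl⟩ := offset_injective hs
  exact ⟨rfl, rfl, rfl⟩

theorem finite_quadratic_roots {a b c : ℝ} (h : ¬ (a = 0 ∧ b = 0)) :
    {x : ℝ | c + b * x + a * x ^ 2 = 0}.Finite := by
  open Polynomial in
  let P : ℝ[X] := C c + C b * X + C a * X ^ 2
  have hP : P ≠ 0 := by
    intro h0
    apply h
    have h1 := congrArg (fun Q : ℝ[X] => Q.coeff 1) h0
    have h2 := congrArg (fun Q : ℝ[X] => Q.coeff 2) h0
    simp [P, coeff_C] at h1 h2
    exact ⟨h2, h1⟩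
  refine P.roots.toFinset.finite_toSet.subset fun x hx => ?_
  simp only [Finset.mem_coe, Multiset.mem_toFinset, mem_roots hP, IsRoot.def, P]
  simpa using hx

/-- For some shear parameter the tiles are pairwise noncongruent. -/
theorem exists_shear_separating : ∃ μ : ℝ, 0 < μ ∧ μ < 1 ∧ ∀ x y : ℤ × ℤ × Fin 8, x ≠ y →
    sumSqSides (vertices μ x.1 x.2.1 x.2.2) ≠ sumSqSides (vertices μ y.1 y.2.1 y.2.2) := by
  let bad : Set ℝ := ⋃ x : ℤ × ℤ × Fin 8, ⋃ y : ℤ × ℤ × Fin 8, ⋃ _ : x ≠ y,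
    {μ | sumSqSides (vertices μ x.1 x.2.1 x.2.2) = sumSqSides (vertices μ y.1 y.2.1 y.2.2)}
  have hbad : bad.Countable := by
    refine Set.countable_iUnion fun x => Set.countable_iUnion fun y =>
      Set.countable_iUnion fun hxy => ?_
    obtain ⟨j, p, i⟩ := x
    obtain ⟨j', p', i'⟩ := y
    have hne : ¬ (verticalMoment i - verticalMoment i' = 0 ∧
        2 * (mixedMoment i + offset j p * verticalMoment i) -
          2 * (mixedMoment i' + offset j' p' * verticalMoment i') = 0) := by
      rintro ⟨h1, h2⟩
      obtain ⟨rfl, rfl, rfl⟩ := index_eq_of_moments_eq (j := j) (p := p) (j' := j') (p' := p')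
        (sub_eq_zero.1 h1) (by linarith)
      exact hxy rfl
    refine ((finite_quadratic_roots (c := sumSqSides (vertices 0 j p i) -
      sumSqSides (vertices 0 j' p' i')) hne).subset fun μ hμ => ?_).countable
    simp only [Set.mem_ofPred_eq, sumSqSides_vertices μ] at hμ ⊢
    linarith
  -- The complement of a countable set of reals is dense, so it meets (0, 1).
  obtain ⟨μ, hμ, h0, h1⟩ := (hbad.dense_compl ℝ).exists_between zero_lt_one
  refine ⟨μ, h0, h1, fun x y hxy h => hμ ?_⟩
  simp only [bad, Set.mem_iUnion]
  exact ⟨x, y, hxy, h⟩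

end PlaneTiling

theorem mainTheorem1 :
    (∃ 𝒯 : Set (Set PlaneTiling.Plane),
      PlaneTiling.IsUnitTriangleTiling 𝒯 ∧
      PlaneTiling.IsNormal 𝒯 ∧
      (∀ S ∈ 𝒯, ∀ T ∈ 𝒯, S ≠ T → ¬ PlaneTiling.AreCongruent S T) ∧
      (∀ T ∈ 𝒯, ∃ p : ℝ, PlaneTiling.HasPerimeter T p ∧ p < 100)) ∧
    (∀ 𝒯 : Set (Set PlaneTiling.Plane), PlaneTiling.IsUnitTriangleTiling 𝒯 →
      (PlaneTiling.IsNormal 𝒯 ↔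
        ∃ c : ℝ, ∀ T ∈ 𝒯, ∃ p : ℝ, PlaneTiling.HasPerimeter T p ∧ p ≤ c)) := by
  open PlaneTiling in
  refine ⟨?_, fun 𝒯 h => isNormal_iff_exists_perimeter_le h⟩
  obtain ⟨μ, h0, h1, hμ⟩ := exists_shear_separating
  have ht := isUnitTriangleTiling_tiles μ
  have hp : ∀ T ∈ tiles μ, ∃ p : ℝ, HasPerimeter T p ∧ p < 100 :=
    fun T hT => exists_perimeter_lt h0 h1 hT
  refine ⟨tiles μ, ht, (isNormal_iff_exists_perimeter_le ht).2 ⟨100, fun T hT => ?_⟩, ?_, hp⟩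
  · obtain ⟨p, hTp, hlt⟩ := hp T hT
    exact ⟨p, hTp, hlt.le⟩
  · rintro _ ⟨j, p, i, -, rfl⟩ _ ⟨j', p', i', -, rfl⟩ hne hc
    refine hμ (j, p, i) (j', p', i') ?_ (hc.sumSqSides_eq (affineIndependent_vertices μ j p i)
      (affineIndependent_vertices μ j' p' i'))
    rintro ⟨⟩
    exact hne rfl
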